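/- Let $X$ and $Y$ be real Banach spaces, let $F:X\times Y\to X$ and $G:X\times Y\to Y$, and let the random sequences $(x_n)_{n\ge 0}$ in $X$ and $(y_n)_{n\ge 0}$ in $Y$, defined on a probability space, satisfy almost surely, for all $n\ge 0$, $$x_{n+1}=x_n+\alpha_{n+1}\,[F(x_n,y_n)+U_{n+1}+c_{n+1}],\qquad y_{n+1}=y_n+\gamma_{n+1}\,[G(x_n,y_n)+V_{n+1}+d_{n+1}],$$ where $\alpha_n,\gamma_n>0$ ($n\ge1$) are (possibly random) step sizes, $U_n,c_n\in X$ and $V_n,d_n\in Y$. For $a\in\{\alpha,\gamma\}$ put $\tau^a_n=\sum_{j=1}^n a_j$ and $m^a(t)=\sup\{k\ge0:\tau^a_k\le t\}$. Assume, almost surely where random quantities are involved: **A1.** (a) For all $T>0$, $\ \sup_{n+1\le k\le m^\alpha(\tau^\alpha_n+T)}\big\|\sum_{j=n}^{k-1}\alpha_{j+1}U_{j+1}\big\|_X\to0$ and $\ \sup_{n+1\le k\le m^\gamma(\tau^\gamma_n+T)}\big\|\sum_{j=n}^{k-1}\gamma_{j+1}V_{j+1}\big\|_Y\to0$ as $n\to\infty$.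 (b) $c_n\to0$ and $d_n\to0$. **A2.** There are (deterministic) compact sets $C\subset X$, $D\subset Y$ with $x_n\in C$ and $y_n\in D$ for all $n$; $F$ and $G$ are bounded and uniformly continuous on $C\times D$. **A3.** $\sum_n\alpha_n=\sum_n\gamma_n=\infty$, $\alpha_n\to0$, $\gamma_n\to0$ and $\alpha_n/\gamma_n\to0$. **A4.** (a) For each $\tilde x\in C$, the equation $\dot y=G(\tilde x,y)$ has, for every initial value in $D$, a unique solution on $[0,\infty)$ that remains in $D$; it has a (necessarily unique) globally attracting fixed point $y^*(\tilde x)\in D$, meaning that $G(\tilde x,y^*(\tilde x))=0$, that the solutions in $D$ starting in some neighbourhood of $y^*(\tilde x)$ in $D$ converge to $y^*(\tilde x)$ uniformly as $t\to\infty$, and that every solution in $D$ converges to $y^*(\tilde x)$; and $y^*:C\to D$ is Lipschitz. (b) The equation $\dot x=F(x,y^*(x))$ has, for every initial value in $C$, a unique solution on $[0,\infty)$ that remains in $C$. Then: 1. Almost surely, $\|y_n-y^*(x_n)\|_Y\to0$ as $n\to\infty$. 2. The equation $\dot x=F(x,y^*(x))$ induces a (jointly continuous) semiflow $\Phi$ on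 $C$, and almost surely the interpolation $\bar x:[0,\infty)\to X$, $\bar x(\tau^\alpha_n+s)=x_n+s\,\frac{x_{n+1}-x_n}{\alpha_{n+1}}$ for $0\le s<\alpha_{n+1}$, is an asymptotic pseudotrajectory of $\Phi$: it is continuous, and for every $T>0$ $$\sup_{0\le s\le T}\big\|\bar x(t+s)-\Phi_s(\bar x(t))\big\|_X\to0\qquad\text{as }t\to\infty,$$ where, if $\bar x$ leaves $C$ (which cannot happen when $C$ is convex), the limit is taken over those $t$ with $\bar x(t)\in C$, that is, over those $t$ for which $\Phi_s(\bar x(t))$ is defined. -/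

import Mathlib

open Set Filter Topology MeasureTheory
open scoped NNReal ENNReal

namespace TwoTimescale

noncomputable section

/-- The time `τ_n = ∑_{j=1}^n a_j` elapsed after `n` steps of sizes `a_1, a_2, …`
(the value `a 0` is never used). -/
def stepTime (a : ℕ → ℝ) (n : ℕ) : ℝ := ∑ j ∈ Finset.Icc 1 n, a j

/-- `m(t) = sup {k ≥ 0 ; τ_k ≤ t}`. -/
def stepIndex (a : ℕ → ℝ) (t : ℝ) : ℕ := sSup {k : ℕ | stepTime a k ≤ t}

/-- The piecewise affine interpolation: its value at time `τ_n + s`, `0 ≤ s < a_{n+1}`, is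
`x_n + s (x_{n+1} - x_n) / a_{n+1}`. For `t ≥ 0` the relevant `n` is `m(t)`. -/
def interpolation {E : Type*} [NormedAddCommGroup E] [NormedSpace ℝ E]
    (a : ℕ → ℝ) (x : ℕ → E) (t : ℝ≥0) : E :=
  x (stepIndex a t) +
    (((t : ℝ) - stepTime a (stepIndex a t)) / a (stepIndex a t + 1)) •
      (x (stepIndex a t + 1) - x (stepIndex a t))

/-- Noise control: for every `T > 0`, the supremum over `k ∈ {n+1, …, m(τ_n + T)}` of
`‖∑_{j=n}^{k-1} a_{j+1} U_{j+1}‖` tends to `0` as `n → ∞`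
(the supremum is taken in `[0, ∞]`, so that over the empty set it is `0`). -/
def NoiseControl {E : Type*} [NormedAddCommGroup E] [NormedSpace ℝ E]
    (a : ℕ → ℝ) (U : ℕ → E) : Prop :=
  ∀ T : ℝ, 0 < T →
    Tendsto (fun n : ℕ => ⨆ k ∈ Finset.Icc (n + 1) (stepIndex a (stepTime a n + T)),
      ‖∑ j ∈ Finset.Ico n k, a (j + 1) • U (j + 1)‖ₑ) atTop (𝓝 0)

/-- Conditions on the slow step sizes `α_n` and the fast step sizes `γ_n`, `n ≥ 1`. -/
structure LearningRates (α γ : ℕ → ℝ) : Prop where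
  slow_pos : ∀ n, 1 ≤ n → 0 < α n
  fast_pos : ∀ n, 1 ≤ n → 0 < γ n
  slow_sum : Tendsto (stepTime α) atTop atTop
  fast_sum : Tendsto (stepTime γ) atTop atTop
  slow_zero : Tendsto α atTop (𝓝 0)
  fast_zero : Tendsto γ atTop (𝓝 0)
  ratio_zero : Tendsto (fun n => α n / γ n) atTop (𝓝 0)

/-- `u` is, on `[0, ∞)`, a solution of `du/dt = f(u)` with `u(0) = u₀` that remains in `S`.
(The derivative at time `0` is one-sided; values of `u` at negative times are irrelevant.) -/
def IsSolutionIn {E : Type*} [NormedAddCommGroup E] [NormedSpace ℝ E]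
    (f : E → E) (S : Set E) (u₀ : E) (u : ℝ → E) : Prop :=
  u 0 = u₀ ∧ ∀ t : ℝ, 0 ≤ t → u t ∈ S ∧ HasDerivWithinAt u (f (u t)) (Ici 0) t

/-- The equation `du/dt = f(u)` has, for every initial value in `S`, a unique solution trajectory
that remains in `S`. -/
def HasUniqueSolutionsIn {E : Type*} [NormedAddCommGroup E] [NormedSpace ℝ E]
    (f : E → E) (S : Set E) : Prop :=
  ∀ u₀ ∈ S, (∃ u : ℝ → E, IsSolutionIn f S u₀ u) ∧
    ∀ u v : ℝ → E, IsSolutionIn f S u₀ u → IsSolutionIn f S u₀ v → EqOn u v (Ici 0)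

/-- `p ∈ S` is a globally attracting fixed point of `du/dt = f(u)` on `S`: it is an equilibrium,
the set `{p}` is an attractor (it attracts the trajectories that start in some neighbourhood of `p`
in `S`, uniformly), and its basin of attraction is the whole of `S`.
There is at most one such `p`. -/
structure IsGloballyAttractingFixedPoint {E : Type*} [NormedAddCommGroup E] [NormedSpace ℝ E]
    (f : E → E) (S : Set E) (p : E) : Prop where
  mem : p ∈ S
  fixed : f p = 0
  attractor : ∃ W ∈ 𝓝[S] p, ∀ ε : ℝ, 0 < ε → ∃ T : ℝ, ∀ u₀ ∈ W, ∀ u : ℝ → E,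
    IsSolutionIn f S u₀ u → ∀ t : ℝ, T ≤ t → 0 ≤ t → dist (u t) p < ε
  basin : ∀ u₀ ∈ S, ∀ u : ℝ → E, IsSolutionIn f S u₀ u → Tendsto u atTop (𝓝 p)

/-- The semiflow `Φ` on the set `S` is the one induced by `du/dt = f(u)`. -/
def IsInducedBy {E : Type*} [NormedAddCommGroup E] [NormedSpace ℝ E] {S : Set E}
    (Φ : Flow ℝ≥0 S) (f : E → E) : Prop :=
  ∀ u₀ : S, IsSolutionIn f S u₀ (fun t : ℝ => (Φ t.toNNReal u₀ : E))

/-- Asymptotic pseudotrajectories of a semiflow `Φ` on a metric space `M`: continuous curves `z`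
with `sup_{0 ≤ s ≤ T} d(z(t+s), Φ_s(z(t))) → 0` as `t → ∞`, for every `T > 0`. -/
def IsAsymptoticPseudotrajectory {M : Type*} [MetricSpace M]
    (Φ : Flow ℝ≥0 M) (z : ℝ≥0 → M) : Prop :=
  Continuous z ∧ ∀ T : ℝ≥0, 0 < T →
    Tendsto (fun t : ℝ≥0 => ⨆ s ∈ Icc (0 : ℝ≥0) T, edist (z (t + s)) (Φ s (z t))) atTop (𝓝 0)

/-- The same property for a semiflow `Φ` on a subset `S` of a metric space `E` and a curve `z`
in `E` that may leave `S`: the limit `t → ∞` is taken over all times `t` with `z(t) ∈ S`, that is,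
over all times at which `Φ_s(z(t))` is defined. -/
def IsAsymptoticPseudotrajectoryWithin {E : Type*} [MetricSpace E] {S : Set E}
    (Φ : Flow ℝ≥0 S) (z : ℝ≥0 → E) : Prop :=
  Continuous z ∧ ∀ T : ℝ≥0, 0 < T →
    Tendsto (fun t : {t : ℝ≥0 // z t ∈ S} =>
        ⨆ s ∈ Icc (0 : ℝ≥0) T, edist (z (t.1 + s)) (Φ s ⟨z t.1, t.2⟩ : E))
      (comap Subtype.val atTop) (𝓝 0)

end

end TwoTimescale

/-! Both claims are compactness arguments along an ultrafilter. Iterates read as a step function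
from a late time on satisfy, up to a vanishing error, a mean value inequality for the limiting
equation (`AsymptoticallySolves`, shown in `asymptoticallySolves_of_recursion`). It involves no
integral, so jumps are harmless, and it passes to limits: in a compact set such curves converge
locally uniformly along any ultrafilter, and the limit solves the equation
(`AsymptoticallySolves.exists_isSolutionIn`).

Tracking: on the fast clock the slow iterates are nearly frozen at some `x₀`
(`slow_almost_constant`). Curves started `T` before the time of `y n` converge to a solution of the
frozen equation. Attraction is uniform on `D`, so for suitable `T` that solution, and hence `y n`,
is close to `yStar x₀` at time `T`.

Pseudotrajectory: on the slow clock, tracking lets `y n` be replaced by `yStar (x n)`, so the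
iterates converge to a slow solution `u`. The semiflow orbits started on the interpolation have
initial values tending to `u 0`; by uniqueness they converge to the same `u`. -/

namespace TwoTimescale

/-! ### Step-size clocks and noise over bounded windows -/

section StepTime

variable {a : ℕ → ℝ}

lemma stepTime_zero (a : ℕ → ℝ) : stepTime a 0 = 0 := by simp [stepTime]

lemma stepTime_succ (a : ℕ → ℝ) (n : ℕ) : stepTime a (n + 1) = stepTime a n + a (n + 1) := by
  simp [stepTime, Finset.sum_Icc_succ_top]

lemma sum_Ico_eq_stepTime_sub (a : ℕ → ℝ) {n k : ℕ} (h : n ≤ k) :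
    ∑ j ∈ Finset.Ico n k, a (j + 1) = stepTime a k - stepTime a n := by
  induction k, h using Nat.le_induction with
  | base => simp
  | succ k hk ih => rw [Finset.sum_Ico_succ_top hk, ih, stepTime_succ]; ring

lemma stepTime_strictMono (ha : ∀ n, 1 ≤ n → 0 < a n) : StrictMono (stepTime a) :=
  strictMono_nat_of_lt_succ fun n => by
    rw [stepTime_succ]; linarith [ha (n + 1) (by omega)]

lemma stepTime_nonneg (ha : ∀ n, 1 ≤ n → 0 < a n) (n : ℕ) : 0 ≤ stepTime a n :=
  (stepTime_zero a).symm.le.trans ((stepTime_strictMono ha).monotone (Nat.zero_le n))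

lemma le_stepIndex_iff (ha : ∀ n, 1 ≤ n → 0 < a n) (hs : Tendsto (stepTime a) atTop atTop)
    {t : ℝ} (ht : 0 ≤ t) {k : ℕ} : k ≤ stepIndex a t ↔ stepTime a k ≤ t := by
  have hmono := stepTime_strictMono ha
  have hne : {k : ℕ | stepTime a k ≤ t}.Nonempty := ⟨0, by simpa [stepTime_zero] using ht⟩
  have hbdd : BddAbove {k : ℕ | stepTime a k ≤ t} := by
    obtain ⟨N, hN⟩ := (hs.eventually_gt_atTop t).exists
    exact ⟨N, fun k hk => (hmono.lt_iff_lt.1 (lt_of_le_of_lt hk hN)).le⟩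
  refine ⟨fun h => ?_, fun h => le_csSup hbdd h⟩
  exact (hmono.monotone h).trans (Nat.sSup_mem hne hbdd)

lemma stepTime_stepIndex_le (ha : ∀ n, 1 ≤ n → 0 < a n) (hs : Tendsto (stepTime a) atTop atTop)
    {t : ℝ} (ht : 0 ≤ t) : stepTime a (stepIndex a t) ≤ t :=
  (le_stepIndex_iff ha hs ht).1 le_rfl

lemma lt_stepTime_stepIndex_succ (ha : ∀ n, 1 ≤ n → 0 < a n)
    (hs : Tendsto (stepTime a) atTop atTop) {t : ℝ} (ht : 0 ≤ t) :
    t < stepTime a (stepIndex a t + 1) := by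
  by_contra! h
  have := (le_stepIndex_iff ha hs ht).2 h
  omega

lemma stepIndex_eq (ha : ∀ n, 1 ≤ n → 0 < a n) (hs : Tendsto (stepTime a) atTop atTop)
    {t : ℝ} {n : ℕ} (h₁ : stepTime a n ≤ t) (h₂ : t < stepTime a (n + 1)) :
    stepIndex a t = n := by
  have ht : 0 ≤ t := (stepTime_nonneg ha n).trans h₁
  refine le_antisymm (Nat.lt_succ_iff.1 ?_) ((le_stepIndex_iff ha hs ht).2 h₁)
  exact (stepTime_strictMono ha).lt_iff_lt.1 ((stepTime_stepIndex_le ha hs ht).trans_lt h₂)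

lemma stepIndex_stepTime (ha : ∀ n, 1 ≤ n → 0 < a n) (hs : Tendsto (stepTime a) atTop atTop)
    (n : ℕ) : stepIndex a (stepTime a n) = n :=
  stepIndex_eq ha hs le_rfl (stepTime_strictMono ha n.lt_succ_self)

lemma stepIndex_mono (ha : ∀ n, 1 ≤ n → 0 < a n) (hs : Tendsto (stepTime a) atTop atTop)
    {s t : ℝ} (h₀ : 0 ≤ s) (h : s ≤ t) : stepIndex a s ≤ stepIndex a t :=
  (le_stepIndex_iff ha hs (h₀.trans h)).2 ((stepTime_stepIndex_le ha hs h₀).trans h)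

lemma tendsto_stepIndex (ha : ∀ n, 1 ≤ n → 0 < a n) (hs : Tendsto (stepTime a) atTop atTop) :
    Tendsto (stepIndex a) atTop atTop := by
  refine tendsto_atTop.2 fun N => ?_
  filter_upwards [eventually_ge_atTop (stepTime a N)] with t ht
  exact (le_stepIndex_iff ha hs ((stepTime_nonneg ha N).trans ht)).2 ht

/-- Sums of `W`, weighted by the step sizes, over late time windows of bounded length
are small. -/
def VanishingNoise {E : Type*} [NormedAddCommGroup E] [NormedSpace ℝ E]
    (a : ℕ → ℝ) (W : ℕ → E) : Prop :=
  ∀ T ε : ℝ, 0 < ε → ∀ᶠ n in atTop, ∀ k, n ≤ k → stepTime a k ≤ stepTime a n + T →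
    ‖∑ j ∈ Finset.Ico n k, a (j + 1) • W (j + 1)‖ ≤ ε

lemma norm_sum_smul_le {E : Type*} [NormedAddCommGroup E] [NormedSpace ℝ E]
    (ha : ∀ n, 1 ≤ n → 0 < a n) {v : ℕ → E} {n k : ℕ} {M : ℝ} (hnk : n ≤ k)
    (hv : ∀ j, n ≤ j → j < k → ‖v j‖ ≤ M) :
    ‖∑ j ∈ Finset.Ico n k, a (j + 1) • v j‖ ≤ (stepTime a k - stepTime a n) * M := by
  rw [← sum_Ico_eq_stepTime_sub a hnk, Finset.sum_mul]
  refine norm_sum_le_of_le _ fun j hj => ?_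
  rw [Finset.mem_Ico] at hj
  have := ha (j + 1) (by omega)
  rw [norm_smul, Real.norm_of_nonneg this.le]
  exact mul_le_mul_of_nonneg_left (hv j hj.1 hj.2) this.le

lemma NoiseControl.vanishingNoise {E : Type*} [NormedAddCommGroup E] [NormedSpace ℝ E]
    (ha : ∀ n, 1 ≤ n → 0 < a n) (hs : Tendsto (stepTime a) atTop atTop)
    {W : ℕ → E} (hW : NoiseControl a W) : VanishingNoise a W := by
  intro T ε hε
  -- `NoiseControl` speaks only of positive window lengths, so the window is enlarged.
  have h := hW (max T 1) (by positivity)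
  have h' := (ENNReal.tendsto_nhds_zero.1 h) (ENNReal.ofReal ε) (by simpa using hε)
  filter_upwards [h'] with n hn k hnk hk
  -- The supremum starts at `n + 1`; for `k = n` the sum is empty.
  rcases hnk.eq_or_lt with rfl | hlt
  · simpa using hε.le
  have hmem : k ∈ Finset.Icc (n + 1) (stepIndex a (stepTime a n + max T 1)) := by
    rw [Finset.mem_Icc]
    refine ⟨hlt, (le_stepIndex_iff ha hs ?_).2 (hk.trans ?_)⟩
    · have := stepTime_nonneg ha n
      positivity
    · gcongr; exact le_max_left _ _
  have := (le_iSup₂ (f := fun k (_ : k ∈ Finset.Icc (n + 1)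
    (stepIndex a (stepTime a n + max T 1))) =>
      ‖∑ j ∈ Finset.Ico n k, a (j + 1) • W (j + 1)‖ₑ) k hmem).trans hn
  rwa [← ofReal_norm, ENNReal.ofReal_le_ofReal_iff hε.le] at this

/-- The weights in a window sum to at most its length, so a null sequence contributes a null sum;
bias terms thus count as noise. -/
lemma VanishingNoise.add_of_tendsto_zero {E : Type*} [NormedAddCommGroup E] [NormedSpace ℝ E]
    (ha : ∀ n, 1 ≤ n → 0 < a n) {W c : ℕ → E} (hW : VanishingNoise a W)
    (hc : Tendsto c atTop (𝓝 0)) : VanishingNoise a (fun n => W n + c n) := by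
  intro T ε hε
  have hδ : 0 < ε / 2 / (|T| + 1) := by positivity
  obtain ⟨N, hN⟩ := eventually_atTop.1 (hc.norm.eventually_le_const (by simpa using hδ))
  filter_upwards [hW T (ε / 2) (by positivity), eventually_ge_atTop N] with n hn hnN k hnk hk
  have h₁ := hn k hnk hk
  have h₂ : ‖∑ j ∈ Finset.Ico n k, a (j + 1) • c (j + 1)‖ ≤ _ :=
    norm_sum_smul_le (v := fun j => c (j + 1)) ha hnk (fun j hj _ => hN (j + 1) (by omega))
  have h₃ : (stepTime a k - stepTime a n) * (ε / 2 / (|T| + 1)) ≤ ε / 2 := by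
    calc _ ≤ (|T| + 1) * (ε / 2 / (|T| + 1)) := by
          gcongr; linarith [le_abs_self T]
      _ = ε / 2 := by field_simp
  simp only [smul_add, Finset.sum_add_distrib]
  exact (norm_add_le _ _).trans (by linarith)

end StepTime

/-! ### Ultrafilter limits of approximate solutions -/

section Limits

variable {E : Type*} [NormedAddCommGroup E] [NormedSpace ℝ E]

/-- Along the filter `l`, the curves `g k` satisfy asymptotically, on bounded time intervals, the
mean value inequality for solutions of `du/dt = f(u)`. -/
def AsymptoticallySolves {ι : Type*} (f : E → E) (l : Filter ι) (g : ι → ℝ → E) : Prop :=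
  ∀ (T ε : ℝ) (v : E) (η : ℝ), 0 < ε → 0 ≤ η → ∀ᶠ k in l, ∀ s t, 0 ≤ s → s ≤ t → t ≤ T →
    (∀ r ∈ Icc s t, ‖f (g k r) - v‖ ≤ η) →
      ‖g k t - g k s - (t - s) • v‖ ≤ (t - s) * η + ε

/-- Asymptotic solutions with values in a compact set converge, along an ultrafilter and locally
uniformly, to a solution. -/
theorem AsymptoticallySolves.exists_isSolutionIn {ι : Type*} {K : Set E} (hK : IsCompact K)
    {f : E → E} (hf : ContinuousOn f K) {𝒰 : Ultrafilter ι} {g : ι → ℝ → E}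
    (hgK : ∀ᶠ k in 𝒰, ∀ t, 0 ≤ t → g k t ∈ K) (hg : AsymptoticallySolves f 𝒰 g) :
    ∃ u : ℝ → E, IsSolutionIn f K (u 0) u ∧
      ∀ T ε : ℝ, 0 < ε → ∀ᶠ k in 𝒰, ∀ t ∈ Icc 0 T, ‖g k t - u t‖ ≤ ε := by
  have hlim : ∀ t : ℝ, ∃ p, 0 ≤ t → p ∈ K ∧ Tendsto (fun k => g k t) 𝒰 (𝓝 p) := by
    intro t
    by_cases ht : 0 ≤ t
    · obtain ⟨p, hp, hle⟩ := hK.ultrafilter_le_nhds (𝒰.map (fun k => g k t))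
        (by rw [le_principal_iff]; exact hgK.mono fun k hk => hk t ht)
      exact ⟨p, fun _ => ⟨hp, hle⟩⟩
    · exact ⟨0, fun h => absurd h ht⟩
  choose u hu using hlim
  have huK : ∀ t, 0 ≤ t → u t ∈ K := fun t ht => (hu t ht).1
  obtain ⟨M, hM⟩ := hK.exists_bound_of_continuousOn hf
  set B := max M 0
  have hB0 : 0 ≤ B := le_max_right _ _
  -- The choice `v = 0`, `η = B` gives a Lipschitz bound up to `ε`, which becomes exact in the
  -- limit.
  have hLipg : ∀ T ε : ℝ, 0 < ε → ∀ᶠ k in 𝒰, ∀ s t, 0 ≤ s → s ≤ t → t ≤ T →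
      ‖g k t - g k s‖ ≤ (t - s) * B + ε := by
    intro T ε hε
    filter_upwards [hg T ε 0 B hε hB0, hgK] with k hk hkK s t hs hst ht
    simpa using hk s t hs hst ht fun r hr => by
      rw [sub_zero]
      exact (hM _ (hkK r (hs.trans hr.1))).trans (le_max_left _ _)
  have hLip : ∀ s t, 0 ≤ s → s ≤ t → ‖u t - u s‖ ≤ (t - s) * B := by
    intro s t hs hst
    refine le_of_forall_pos_le_add fun ε hε => ?_
    exact le_of_tendsto (((hu t (hs.trans hst)).2.sub (hu s hs).2).norm)
      ((hLipg t ε hε).mono fun k hk => hk s t hs hst le_rfl)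
  have hunif : ∀ T ε : ℝ, 0 < ε → ∀ᶠ k in 𝒰, ∀ t ∈ Icc 0 T, ‖g k t - u t‖ ≤ ε := by
    intro T ε hε
    -- Mesh of a finite time grid: pointwise convergence on the grid and the Lipschitz bounds
    -- between grid points give uniform convergence.
    set δ := ε / 4 / (B + 1) with hδ
    have hδ0 : 0 < δ := by positivity
    have hδB : δ * B ≤ ε / 4 := by
      calc δ * B ≤ δ * (B + 1) := by gcongr; linarith
        _ = ε / 4 := by rw [hδ]; field_simp
    have hfin : ∀ᶠ k in 𝒰, ∀ i ∈ Finset.range (⌊T / δ⌋₊ + 1),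
        ‖g k (i * δ) - u (i * δ)‖ ≤ ε / 4 := by
      rw [Filter.eventually_all_finset]
      intro i _
      have := (hu (i * δ) (by positivity)).2
      filter_upwards [Metric.tendsto_nhds.1 this (ε / 4) (by positivity)] with k hk
      rw [← dist_eq_norm]; exact hk.le
    filter_upwards [hfin, hLipg T (ε / 4) (by positivity)] with k hk hkL t ht
    set i := ⌊t / δ⌋₊ with hi
    have h₁ : i * δ ≤ t := by
      have := Nat.floor_le (div_nonneg ht.1 hδ0.le)
      rwa [le_div_iff₀ hδ0] at this
    have h₂ : t - i * δ ≤ δ := by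
      have := (Nat.lt_floor_add_one (t / δ)).le
      rw [div_le_iff₀ hδ0] at this
      linarith
    have h₃ : i ∈ Finset.range (⌊T / δ⌋₊ + 1) := by
      rw [Finset.mem_range, Nat.lt_succ_iff]
      exact Nat.floor_le_floor (by gcongr; exact ht.2)
    have e₀ : (t - i * δ) * B ≤ ε / 4 := (by gcongr : _ ≤ δ * B).trans hδB
    have e₁ := hkL (i * δ) t (by positivity) h₁ ht.2
    have e₂ := hLip (i * δ) t (by positivity) h₁
    have e₃ := hk i h₃
    have : g k t - u t = (g k t - g k (i * δ)) + (g k (i * δ) - u (i * δ))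
      - (u t - u (i * δ)) := by abel
    rw [this]
    refine (norm_sub_le _ _).trans ?_
    linarith [norm_add_le (g k t - g k (i * δ)) (g k (i * δ) - u (i * δ))]
  refine ⟨u, ⟨rfl, fun t ht => ⟨huK t ht, ?_⟩⟩, hunif⟩
  have hucont : ContinuousOn u (Ici 0) := by
    refine (LipschitzOnWith.of_dist_le_mul (K := B.toNNReal) fun s hs t ht => ?_).continuousOn
    rw [Real.coe_toNNReal _ hB0, dist_eq_norm, Real.dist_eq, mul_comm]
    rcases le_total s t with h | h
    · rw [norm_sub_rev, abs_sub_comm, abs_of_nonneg (sub_nonneg.2 h)]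
      exact hLip s t hs h
    · rw [abs_of_nonneg (sub_nonneg.2 h)]
      exact hLip t s ht h
  rw [hasDerivWithinAt_iff_isLittleO, Asymptotics.isLittleO_iff]
  intro c hc
  have hfu : ContinuousOn (fun r => f (u r)) (Ici 0) := hf.comp hucont fun r hr => huK r hr
  obtain ⟨δ, hδ, hδ'⟩ := Metric.continuousWithinAt_iff.1 (hfu t ht) (c / 2) (by positivity)
  -- the basic estimate on intervals contained in the `δ`-neighbourhood of `t`
  have key : ∀ s s', 0 ≤ s → s ≤ s' → (∀ r ∈ Icc s s', dist r t < δ) →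
      ‖u s' - u s - (s' - s) • f (u t)‖ ≤ (s' - s) * c := by
    intro s s' hs hss hball
    refine le_of_forall_pos_le_add fun ε hε => ?_
    have hs' := hs.trans hss
    have hclose : ∀ᶠ k in 𝒰, ∀ r ∈ Icc s s', ‖f (g k r) - f (u t)‖ ≤ c := by
      have huc := hK.uniformContinuousOn_of_continuous hf
      obtain ⟨ρ, hρ, hρ'⟩ := Metric.uniformContinuousOn_iff.1 huc (c / 2) (by positivity)
      filter_upwards [hunif s' (ρ / 2) (by positivity), hgK] with k hk hkK r hr
      have hr0 : 0 ≤ r := hs.trans hr.1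
      have h₁ : dist (f (g k r)) (f (u r)) < c / 2 := by
        refine hρ' _ (hkK r hr0) _ (huK r hr0) ?_
        rw [dist_eq_norm]
        linarith [hk r ⟨hr0, hr.2⟩]
      have h₂ : dist (f (u r)) (f (u t)) < c / 2 := hδ' hr0 (hball r hr)
      rw [← dist_eq_norm]
      linarith [dist_triangle (f (g k r)) (f (u r)) (f (u t))]
    refine le_of_tendsto ((((hu s' hs').2.sub (hu s hs).2).sub_const
      ((s' - s) • f (u t))).norm) ?_
    filter_upwards [hclose, hg s' ε (f (u t)) c hε hc.le] with k h₁ h₂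
    exact h₂ s s' hs hss le_rfl h₁
  filter_upwards [inter_mem_nhdsWithin (Ici 0) (Metric.ball_mem_nhds t hδ)] with r hr
  have hr0 : 0 ≤ r := hr.1
  have hrt : |r - t| < δ := hr.2
  rw [Real.norm_eq_abs]
  rcases le_total t r with h | h
  · rw [abs_of_nonneg (sub_nonneg.2 h)] at hrt ⊢
    rw [mul_comm]
    refine key t r ht h fun q hq => ?_
    rw [Real.dist_eq, abs_of_nonneg (sub_nonneg.2 hq.1)]
    linarith [hq.2]
  · rw [abs_of_nonpos (sub_nonpos.2 h)] at hrt ⊢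
    have := key r t hr0 h fun q hq => by
      rw [Real.dist_eq, abs_of_nonpos (sub_nonpos.2 hq.2)]
      linarith [hq.1]
    have e : u r - u t - (r - t) • f (u t) = -(u t - u r - (t - r) • f (u t)) := by
      rw [sub_smul, sub_smul]; abel
    rw [e, norm_neg, neg_sub, mul_comm]
    exact this

lemma IsSolutionIn.continuousOn {K : Set E} {f : E → E} {u₀ : E} {u : ℝ → E}
    (hu : IsSolutionIn f K u₀ u) : ContinuousOn u (Ici 0) :=
  fun t ht => (hu.2 t ht).2.continuousWithinAt

/-- The mean value inequality for `r ↦ g k r - r • v` holds here without error. Families of exact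
solutions thereby fall under the same compactness theorem. -/
lemma asymptoticallySolves_of_isSolutionIn {ι : Type*} {K : Set E} {f : E → E} {l : Filter ι}
    {g : ι → ℝ → E} (hg : ∀ k, ∃ p, IsSolutionIn f K p (g k)) : AsymptoticallySolves f l g := by
  intro T ε v η hε _
  refine Eventually.of_forall fun k s t hs hst _ hbound => ?_
  obtain ⟨p, hp⟩ := hg k
  have hd : ∀ r ∈ Icc s t, HasDerivWithinAt (fun r => g k r - r • v) (f (g k r) - v)
      (Icc s t) r := by
    intro r hr
    have h₁ := (hp.2 r (hs.trans hr.1)).2.mono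
      (fun q hq => hs.trans hq.1 : Icc s t ⊆ Ici 0)
    have h₂ := ((hasDerivAt_id r).smul_const v).hasDerivWithinAt (s := Icc s t)
    rw [one_smul] at h₂
    exact h₁.sub h₂
  have := norm_image_sub_le_of_norm_deriv_le_segment' hd
    (fun r hr => hbound r ⟨hr.1, hr.2.le⟩) t ⟨hst, le_rfl⟩
  have e : g k t - g k s - (t - s) • v = (g k t - t • v) - (g k s - s • v) := by
    rw [sub_smul]; abel
  rw [e, mul_comm]
  exact this.trans (by linarith)

lemma IsSolutionIn.shift {K : Set E} {f : E → E} {u₀ : E} {u : ℝ → E}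
    (hu : IsSolutionIn f K u₀ u) {s : ℝ} (hs : 0 ≤ s) :
    IsSolutionIn f K (u s) (fun t => u (t + s)) := by
  refine ⟨by simp, fun t ht => ⟨(hu.2 (t + s) (by positivity)).1, ?_⟩⟩
  have h₁ := (hu.2 (t + s) (by positivity)).2
  have h₂ : HasDerivWithinAt (fun t => t + s) 1 (Ici 0) t :=
    ((hasDerivAt_id t).add_const s).hasDerivWithinAt
  simpa [Function.comp_def] using
    h₁.scomp t h₂ (fun r (hr : (0 : ℝ) ≤ r) => (by positivity : (0 : ℝ) ≤ r + s))

/-- On a compact set, a globally attracting fixed point attracts uniformly. -/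
theorem IsGloballyAttractingFixedPoint.uniform {K : Set E} (hK : IsCompact K) {f : E → E}
    (hf : ContinuousOn f K) {p : E} (hp : IsGloballyAttractingFixedPoint f K p)
    {ε : ℝ} (hε : 0 < ε) :
    ∃ T : ℝ, 0 ≤ T ∧ ∀ u₀ u, IsSolutionIn f K u₀ u → ∀ t, T ≤ t → dist (u t) p < ε := by
  by_contra! hcon
  -- Counterexamples with `t n ≥ n`. Their limit solution comes within `ρ / 2` of `p` at some time
  -- `S`, so some late `g n` lies in `W` at time `S` and is attracted before `t n`.
  choose u₀ g hg t ht hdist using fun n : ℕ => hcon n n.cast_nonneg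
  let 𝒰 : Ultrafilter ℕ := Ultrafilter.of atTop
  have h𝒰 : (𝒰 : Filter ℕ) ≤ atTop := Ultrafilter.of_le _
  obtain ⟨u, hu, hunif⟩ := (asymptoticallySolves_of_isSolutionIn (l := 𝒰)
    fun k => ⟨u₀ k, hg k⟩).exists_isSolutionIn hK hf
      (Eventually.of_forall fun k r hr => ((hg k).2 r hr).1)
  obtain ⟨W, hW, hWattr⟩ := hp.attractor
  obtain ⟨T, hT⟩ := hWattr ε hε
  obtain ⟨ρ, hρ, hρW⟩ := Metric.mem_nhdsWithin_iff.1 hW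
  have hlim := hp.basin (u 0) (hu.2 0 le_rfl).1 u hu
  obtain ⟨S, hS0, hS⟩ : ∃ S, 0 ≤ S ∧ dist (u S) p < ρ / 2 :=
    ((eventually_ge_atTop 0).and (Metric.tendsto_nhds.1 hlim (ρ / 2) (by positivity))).exists
  have hbig : ∀ᶠ n : ℕ in 𝒰, S + max T 0 ≤ n :=
    h𝒰 (tendsto_natCast_atTop_atTop.eventually_ge_atTop _)
  obtain ⟨n, hn, hnbig⟩ := ((hunif S (ρ / 2) (by positivity)).and hbig).exists
  have hmem : g n S ∈ W := by
    refine hρW ⟨?_, ((hg n).2 S hS0).1⟩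
    have := hn S ⟨hS0, le_rfl⟩
    rw [← dist_eq_norm] at this
    rw [Metric.mem_ball]
    linarith [dist_triangle (g n S) (u S) p]
  have htn := ht n
  have := hT (g n S) hmem _ ((hg n).shift hS0) (t n - S)
    (by linarith [le_max_left T 0]) (by linarith [le_max_right T 0])
  rw [sub_add_cancel] at this
  linarith [hdist n]

/-- Solutions in a compact set depend continuously, locally uniformly in time, on the initial
value. -/
theorem HasUniqueSolutionsIn.eventually_close {ι : Type*} {K : Set E} (hK : IsCompact K)
    {f : E → E} (hf : ContinuousOn f K) (huniq : HasUniqueSolutionsIn f K) {𝒰 : Ultrafilter ι}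
    {p : ι → E} {g : ι → ℝ → E} (hg : ∀ k, IsSolutionIn f K (p k) (g k))
    {u : ℝ → E} (hu : IsSolutionIn f K (u 0) u) (hp : Tendsto p 𝒰 (𝓝 (u 0))) (T : ℝ)
    {ε : ℝ} (hε : 0 < ε) : ∀ᶠ k in 𝒰, ∀ t ∈ Icc 0 T, ‖g k t - u t‖ ≤ ε := by
  obtain ⟨v, hv, hunif⟩ := (asymptoticallySolves_of_isSolutionIn (l := 𝒰)
    fun k => ⟨p k, hg k⟩).exists_isSolutionIn hK hf
      (Eventually.of_forall fun k r hr => ((hg k).2 r hr).1)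
  have h0 : v 0 = u 0 := by
    refine tendsto_nhds_unique (f := p) (l := 𝒰) ?_ hp
    rw [Metric.tendsto_nhds]
    intro ε hε
    filter_upwards [hunif 0 (ε / 2) (by positivity)] with k hk
    have := hk 0 ⟨le_rfl, le_rfl⟩
    rw [(hg k).1, ← dist_eq_norm] at this
    linarith
  have heq := (huniq (u 0) (hu.2 0 le_rfl).1).2 u v hu (h0 ▸ hv)
  filter_upwards [hunif T ε hε] with k hk t ht
  rw [heq ht.1]
  exact hk t ht

/-- Uniqueness gives the semigroup law and, through `eventually_close`, joint continuity. -/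
theorem HasUniqueSolutionsIn.exists_flow {K : Set E} (hK : IsCompact K) {f : E → E}
    (hf : ContinuousOn f K) (huniq : HasUniqueSolutionsIn f K) :
    ∃ Φ : Flow ℝ≥0 K, IsInducedBy Φ f := by
  choose u hu using fun p : K => (huniq p p.2).1
  have hmem : ∀ (p : K) (t : ℝ≥0), u p t ∈ K := fun p t => ((hu p).2 t t.2).1
  have hu0 : ∀ p, u p 0 = p := fun p => (hu p).1
  refine ⟨⟨fun t p => ⟨u p t, hmem p t⟩, ?_, fun s t p => ?_, fun p => ?_⟩, fun p => ?_⟩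
  · rw [continuous_iff_ultrafilter]
    rintro ⟨t, p⟩ 𝒰 h𝒰
    have hfst : Tendsto (fun q : ℝ≥0 × K => (q.1 : ℝ)) 𝒰 (𝓝 t) :=
      ((NNReal.continuous_coe.comp continuous_fst).tendsto (t, p)).mono_left h𝒰
    have hsnd : Tendsto (fun q : ℝ≥0 × K => (q.2 : E)) 𝒰 (𝓝 p) :=
      ((continuous_subtype_val.comp continuous_snd).tendsto (t, p)).mono_left h𝒰
    rw [tendsto_subtype_rng]
    change Tendsto (fun q : ℝ≥0 × K => u q.2 q.1) 𝒰 (𝓝 (u p t))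
    have hc : Tendsto (fun q : ℝ≥0 × K => u p q.1) 𝒰 (𝓝 (u p t)) :=
      ((hu p).continuousOn t t.2).tendsto.comp
        (tendsto_nhdsWithin_iff.2 ⟨hfst, Eventually.of_forall fun q => q.1.2⟩)
    rw [Metric.tendsto_nhds] at hc ⊢
    intro ε hε
    -- The horizon `t + 1` contains all times close to `t`.
    have h1 := huniq.eventually_close hK hf (𝒰 := 𝒰) (g := fun q : ℝ≥0 × K => u q.2)
      (p := fun q => (q.2 : E)) (fun q => hu q.2) (u := u p) ((hu0 p).symm ▸ hu p)
      (by rwa [hu0 p]) (t + 1) (ε := ε / 2) (by positivity)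
    filter_upwards [h1, hc (ε / 2) (by positivity),
      hfst.eventually_le_const (lt_add_one (t : ℝ))] with q h₁ h₂ h₃
    have := h₁ q.1 ⟨q.1.2, h₃⟩
    rw [← dist_eq_norm] at this
    linarith [dist_triangle (u q.2 q.1) (u p q.1) (u p t)]
  · refine Subtype.ext ?_
    have h₁ := (hu p).shift t.2
    have h₂ := hu ⟨u p t, hmem p t⟩
    have := (huniq _ (hmem p t)).2 _ _ h₁ h₂ (x := (s : ℝ)) s.2
    simpa using this
  · exact Subtype.ext (hu0 p)
  · refine ⟨by simpa using hu0 p, fun t ht => ⟨hmem p _, ?_⟩⟩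
    have h := ((hu p).2 t ht).2
    have e : ∀ r ∈ Ici (0 : ℝ), u p (r.toNNReal) = u p r := fun r hr => by
      rw [Real.coe_toNNReal r hr]
    change HasDerivWithinAt (fun r : ℝ => u p r.toNNReal) (f (u p t.toNNReal)) (Ici 0) t
    rw [e t ht]
    exact h.congr e (e t ht)

end Limits

/-! ### Stochastic approximation schemes and their interpolation -/

section Scheme

variable {E : Type*} [NormedAddCommGroup E] [NormedSpace ℝ E]

lemma sub_eq_sum_of_recursion {a : ℕ → ℝ} {z w : ℕ → E}
    (hz : ∀ n, z (n + 1) = z n + a (n + 1) • w n) {n k : ℕ} (h : n ≤ k) :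
    z k - z n = ∑ j ∈ Finset.Ico n k, a (j + 1) • w j := by
  rw [← Finset.sum_Ico_sub z h]
  exact Finset.sum_congr rfl fun j _ => by rw [hz]; abel

/-- The iterates of a stochastic approximation scheme, sampled from late times on, satisfy
asymptotically the mean value inequality of the limiting equation. -/
theorem asymptoticallySolves_of_recursion {a : ℕ → ℝ} (ha : ∀ n, 1 ≤ n → 0 < a n)
    (hs : Tendsto (stepTime a) atTop atTop) (ha0 : Tendsto a atTop (𝓝 0)) {z p W : ℕ → E}
    (hz : ∀ n, z (n + 1) = z n + a (n + 1) • (p n + W (n + 1))) (hW : VanishingNoise a W)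
    {f : E → E} {ι : Type*} {l : Filter ι} {t : ι → ℝ} (ht : Tendsto t l atTop)
    (hp : ∀ T ε : ℝ, 0 < ε → ∀ᶠ k in l, ∀ j, stepIndex a (t k) ≤ j →
      stepTime a j ≤ t k + T → ‖p j - f (z j)‖ ≤ ε) :
    AsymptoticallySolves f l (fun k s => z (stepIndex a (t k + s))) := by
  intro T ε v η hε hη
  -- `δ` bounds the drift error `p j - f (z j)`; `δ'` bounds late step sizes, hence the mismatch
  -- between elapsed time and step time.
  set δ := ε / 4 / (|T| + 1) with hδ
  have hδ0 : 0 < δ := by positivity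
  set δ' := min 1 (ε / 4 / (η + δ + ‖v‖ + 1))
  have hδ'0 : 0 < δ' := by positivity
  have hδ'1 : δ' ≤ 1 := min_le_left _ _
  have hδ'2 : δ' * (η + δ + ‖v‖) ≤ ε / 4 := by
    calc _ ≤ (ε / 4 / (η + δ + ‖v‖ + 1)) * (η + δ + ‖v‖ + 1) := by
          refine mul_le_mul (min_le_right _ _) (by linarith) (by positivity) (by positivity)
      _ = ε / 4 := by field_simp
  obtain ⟨N, hN⟩ := eventually_atTop.1 (ha0.eventually_le_const hδ'0)
  obtain ⟨N', hN'⟩ := eventually_atTop.1 (hW (T + 1) (ε / 4) (by positivity))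
  filter_upwards [hp T δ hδ0, ht.eventually_ge_atTop 0,
    ((tendsto_stepIndex ha hs).comp ht).eventually_ge_atTop (max N N')]
    with k hpk htk hmk s s' h0s hss hsT hbound
  replace hmk : max N N' ≤ stepIndex a (t k) := hmk
  have h0 : 0 ≤ t k + s := by positivity
  have h0' : 0 ≤ t k + s' := by linarith
  have hmn : stepIndex a (t k) ≤ stepIndex a (t k + s) := stepIndex_mono ha hs htk (by linarith)
  have hnn : stepIndex a (t k + s) ≤ stepIndex a (t k + s') := stepIndex_mono ha hs h0 (by linarith)
  have h₁ := stepTime_stepIndex_le ha hs h0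
  have h₂ := lt_stepTime_stepIndex_succ ha hs h0
  have h₁' := stepTime_stepIndex_le ha hs h0'
  have h₂' := lt_stepTime_stepIndex_succ ha hs h0'
  set n := stepIndex a (t k + s) with hn
  set n' := stepIndex a (t k + s') with hn'
  have hNn : N ≤ n := (le_max_left _ _).trans (hmk.trans hmn)
  have hNn' : N' ≤ n := (le_max_right _ _).trans (hmk.trans hmn)
  have hstep : stepTime a (n + 1) ≤ stepTime a n + δ' := by
    rw [stepTime_succ]; linarith [hN (n + 1) (by omega)]
  have hstep' : stepTime a (n' + 1) ≤ stepTime a n' + δ' := by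
    rw [stepTime_succ]; linarith [hN (n' + 1) (by omega)]
  have hpv : ∀ j, n ≤ j → j < n' → ‖p j - v‖ ≤ η + δ := by
    intro j hj hj'
    -- For `j = n` the step may begin before `t k + s`, where `hbound` says nothing; the maximum
    -- with `s` picks a time in the interval with the same index.
    have hjt : stepTime a j ≤ t k + s' := ((stepTime_strictMono ha).monotone hj'.le).trans h₁'
    have hr : stepIndex a (t k + max (stepTime a j - t k) s) = j := by
      refine stepIndex_eq ha hs (by linarith [le_max_left (stepTime a j - t k) s]) ?_
      have e₁ : stepTime a j < stepTime a (j + 1) := stepTime_strictMono ha j.lt_succ_self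
      have e₂ : stepTime a (n + 1) ≤ stepTime a (j + 1) :=
        (stepTime_strictMono ha).monotone (by omega)
      have : max (stepTime a j - t k) s < stepTime a (j + 1) - t k :=
        max_lt (by linarith) (by linarith)
      linarith
    have hb := hbound (max (stepTime a j - t k) s)
      ⟨le_max_right _ _, max_le (by linarith) hss⟩
    rw [hr] at hb
    have := norm_add_le (p j - f (z j)) (f (z j) - v)
    rw [sub_add_sub_cancel] at this
    linarith [hpk j (hmn.trans hj) (hjt.trans (by linarith))]
  have hnoise := hN' n hNn' n' hnn (by linarith)
  have hdrift : ‖∑ j ∈ Finset.Ico n n', a (j + 1) • (p j - v)‖ ≤ _ := norm_sum_smul_le ha hnn hpv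
  set Δ := stepTime a n' - stepTime a n with hΔ
  have hΔ1 : |Δ - (s' - s)| ≤ δ' := by rw [abs_le]; constructor <;> linarith
  -- Drift deviation, clock mismatch and noise.
  have e : z n' - z n - (s' - s) • v = ∑ j ∈ Finset.Ico n n', a (j + 1) • (p j - v)
      + (Δ - (s' - s)) • v + ∑ j ∈ Finset.Ico n n', a (j + 1) • W (j + 1) := by
    rw [sub_eq_sum_of_recursion hz hnn, hΔ, ← sum_Ico_eq_stepTime_sub a hnn, sub_smul _ (s' - s)]
    simp only [smul_add, smul_sub, Finset.sum_add_distrib, Finset.sum_sub_distrib, Finset.sum_smul]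
    abel
  change ‖z n' - z n - (s' - s) • v‖ ≤ _
  rw [e]
  refine (norm_add₃_le).trans ?_
  have hv : ‖(Δ - (s' - s)) • v‖ ≤ δ' * ‖v‖ := by
    rw [norm_smul, Real.norm_eq_abs]; gcongr
  have hd : Δ * (η + δ) ≤ (s' - s) * η + (s' - s) * δ + δ' * (η + δ) := by
    have : Δ ≤ (s' - s) + δ' := by linarith [le_abs_self (Δ - (s' - s))]
    calc Δ * (η + δ) ≤ ((s' - s) + δ') * (η + δ) := by gcongr
      _ = _ := by ring
  have hsδ : (s' - s) * δ ≤ ε / 4 := by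
    calc (s' - s) * δ ≤ (|T| + 1) * δ := by gcongr; linarith [le_abs_self T]
      _ = ε / 4 := by rw [hδ]; field_simp
  have : δ' * (η + δ) + δ' * ‖v‖ ≤ ε / 4 := by rw [← mul_add]; exact hδ'2
  linarith

/-- The slow iterates hardly move in fast time windows of bounded length. -/
theorem LearningRates.slow_almost_constant {α γ : ℕ → ℝ} (hr : LearningRates α γ)
    {z p W : ℕ → E} {M : ℝ} (hp : ∀ n, ‖p n‖ ≤ M)
    (hz : ∀ n, z (n + 1) = z n + α (n + 1) • (p n + W (n + 1))) (hW : VanishingNoise α W)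
    (T : ℝ) {ε : ℝ} (hε : 0 < ε) :
    ∀ᶠ n in atTop, ∀ k, n ≤ k → stepTime γ k ≤ stepTime γ n + T → ‖z k - z n‖ ≤ ε := by
  have hM : 0 ≤ M := (norm_nonneg _).trans (hp 0)
  set δ := ε / 2 / ((|T| + 1) * (M + 1)) with hδ
  have hδ0 : 0 < δ := by positivity
  obtain ⟨N, hN⟩ := eventually_atTop.1 (hr.ratio_zero.eventually_le_const hδ0)
  filter_upwards [hW (δ * (|T| + 1)) (ε / 2) (by positivity), eventually_ge_atTop N]
    with n hn hnN k hnk hk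
  -- Since `α ≤ δ γ` eventually, a bounded fast window is a short slow window.
  have hτ : stepTime α k - stepTime α n ≤ δ * (|T| + 1) := by
    calc stepTime α k - stepTime α n = ∑ j ∈ Finset.Ico n k, α (j + 1) :=
          (sum_Ico_eq_stepTime_sub α hnk).symm
      _ ≤ ∑ j ∈ Finset.Ico n k, δ * γ (j + 1) := by
          refine Finset.sum_le_sum fun j hj => ?_
          have hj' := (Finset.mem_Ico.1 hj).1
          exact (div_le_iff₀ (hr.fast_pos (j + 1) (by omega))).1 (hN (j + 1) (by omega))
      _ = δ * (stepTime γ k - stepTime γ n) := by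
          rw [← Finset.mul_sum, sum_Ico_eq_stepTime_sub γ hnk]
      _ ≤ δ * (|T| + 1) := by gcongr; linarith [le_abs_self T]
  have h₁ : ‖∑ j ∈ Finset.Ico n k, α (j + 1) • p j‖ ≤ _ :=
    norm_sum_smul_le hr.slow_pos hnk fun j _ _ => hp j
  have h₂ := hn k hnk (by linarith)
  have h₃ : (stepTime α k - stepTime α n) * M ≤ ε / 2 := by
    calc _ ≤ (δ * (|T| + 1)) * (M + 1) := by
          gcongr
          · linarith
      _ = ε / 2 := by rw [hδ]; field_simp
  rw [sub_eq_sum_of_recursion hz hnk]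
  simp only [smul_add, Finset.sum_add_distrib]
  exact (norm_add_le _ _).trans (by linarith)

lemma norm_interpolation_sub_le {a : ℕ → ℝ} (ha : ∀ n, 1 ≤ n → 0 < a n)
    (hs : Tendsto (stepTime a) atTop atTop) (z : ℕ → E) (t : ℝ≥0) :
    ‖interpolation a z t - z (stepIndex a t)‖ ≤ ‖z (stepIndex a t + 1) - z (stepIndex a t)‖ := by
  have h₁ := stepTime_stepIndex_le ha hs (NNReal.coe_nonneg t)
  have h₂ := lt_stepTime_stepIndex_succ ha hs (NNReal.coe_nonneg t)
  rw [stepTime_succ] at h₂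
  have h₃ := ha (stepIndex a t + 1) (by omega)
  rw [interpolation, add_sub_cancel_left, norm_smul, Real.norm_eq_abs]
  refine mul_le_of_le_one_left (norm_nonneg _) ?_
  rw [abs_of_nonneg (div_nonneg (sub_nonneg.2 h₁) h₃.le), div_le_one h₃]
  exact sub_le_iff_le_add'.2 h₂.le

/-- The closed step intervals form a locally finite cover, and the interpolation is affine on each.
-/
lemma continuous_interpolation {a : ℕ → ℝ} (ha : ∀ n, 1 ≤ n → 0 < a n)
    (hs : Tendsto (stepTime a) atTop atTop) (z : ℕ → E) : Continuous (interpolation a z) := by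
  have hmono := stepTime_strictMono ha
  let S : ℕ → Set ℝ≥0 := fun n => (↑) ⁻¹' Icc (stepTime a n) (stepTime a (n + 1))
  have hlf : LocallyFinite S := by
    intro t
    obtain ⟨N, hN⟩ := (hs.eventually_gt_atTop (t : ℝ)).exists
    refine ⟨(↑) ⁻¹' Iio (stepTime a N),
      NNReal.continuous_coe.continuousAt.preimage_mem_nhds (Iio_mem_nhds hN),
      (finite_lt_nat N).subset ?_⟩
    rintro n ⟨r, hr, hr'⟩
    exact hmono.lt_iff_lt.1 (lt_of_le_of_lt hr.1 hr')
  refine hlf.continuous ?_ (fun n => isClosed_Icc.preimage NNReal.continuous_coe) fun n => ?_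
  · refine eq_univ_of_forall fun t => mem_iUnion.2 ⟨stepIndex a t, ?_⟩
    exact ⟨stepTime_stepIndex_le ha hs (NNReal.coe_nonneg t), (lt_stepTime_stepIndex_succ ha hs (NNReal.coe_nonneg t)).le⟩
  · have hcont : Continuous fun t : ℝ≥0 =>
        z n + (((t : ℝ) - stepTime a n) / a (n + 1)) • (z (n + 1) - z n) := by fun_prop
    refine hcont.continuousOn.congr fun t ht => ?_
    -- At the right endpoint the index has already jumped to `n + 1`; both formulas give `z (n +
    -- 1)`.
    rcases ht.2.lt_or_eq with h | h
    · rw [interpolation, stepIndex_eq ha hs ht.1 h]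
    · have h₃ := (ha (n + 1) (by omega)).ne'
      rw [interpolation, h, stepIndex_stepTime ha hs (n + 1), stepTime_succ]
      simp only [h, stepTime_succ, sub_self, zero_div, zero_smul, add_zero, add_sub_cancel_left,
        div_self h₃, one_smul, add_sub_cancel]

end Scheme

/-! ### Tracking and the asymptotic pseudotrajectory -/

section TwoScales

variable {X Y : Type*} [NormedAddCommGroup X] [NormedSpace ℝ X]
  [NormedAddCommGroup Y]
  {F : X × Y → X} {G : X × Y → Y} {α γ : ℕ → ℝ} {x : ℕ → X} {y : ℕ → Y} {W : ℕ → X} {Z : ℕ → Y}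
  {C : Set X} {D : Set Y} {yStar : X → Y}

/-- Serves to replace one argument of the mean field, by the frozen `x₀` or by `yStar (x j)`. -/
lemma eventually_norm_sub_le_of_uniformContinuousOn {A B ι : Type*} [PseudoMetricSpace A]
    [SeminormedAddCommGroup B] {H : A → B} {S : Set A} (hH : UniformContinuousOn H S)
    {P : ι → ℕ → Prop} {l : Filter ι} {q q' : ℕ → A} (hq : ∀ j, q j ∈ S) (hq' : ∀ j, q' j ∈ S)
    (h : ∀ ε : ℝ, 0 < ε → ∀ᶠ k in l, ∀ j, P k j → dist (q j) (q' j) ≤ ε) {ε : ℝ} (hε : 0 < ε) :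
    ∀ᶠ k in l, ∀ j, P k j → ‖H (q j) - H (q' j)‖ ≤ ε := by
  obtain ⟨δ, hδ, hδ'⟩ := Metric.uniformContinuousOn_iff.1 hH ε hε
  filter_upwards [h (δ / 2) (by positivity)] with k hk j hj
  rw [← dist_eq_norm]
  exact (hδ' _ (hq j) _ (hq' j) ((hk j hj).trans_lt (by linarith))).le

variable [NormedSpace ℝ Y] in
/-- The fast iterates track the attracting fixed point of the fast equation. -/
theorem LearningRates.tendsto_norm_sub_yStar (hr : LearningRates α γ)
    (hx : ∀ n, x (n + 1) = x n + α (n + 1) • (F (x n, y n) + W (n + 1)))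
    (hy : ∀ n, y (n + 1) = y n + γ (n + 1) • (G (x n, y n) + Z (n + 1)))
    (hW : VanishingNoise α W) (hZ : VanishingNoise γ Z)
    (hC : IsCompact C) (hD : IsCompact D) (hxC : ∀ n, x n ∈ C) (hyD : ∀ n, y n ∈ D)
    (hFb : Bornology.IsBounded (F '' (C ×ˢ D))) (hGc : UniformContinuousOn G (C ×ˢ D))
    (hattr : ∀ x₀ ∈ C, IsGloballyAttractingFixedPoint (fun v => G (x₀, v)) D (yStar x₀))
    (hcont : ContinuousOn yStar C) :
    Tendsto (fun n => ‖y n - yStar (x n)‖) atTop (𝓝 0) := by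
  obtain ⟨M, hM⟩ := hFb.exists_norm_le
  have hFM : ∀ n, ‖F (x n, y n)‖ ≤ M := fun n => hM _ ⟨_, ⟨hxC n, hyD n⟩, rfl⟩
  have hslow := fun (T : ℝ) {ε : ℝ} (hε : 0 < ε) =>
    hr.slow_almost_constant hFM hx hW T hε
  rw [tendsto_iff_ultrafilter]
  intro 𝒰 h𝒰
  obtain ⟨x₀, hx₀, hlim : Tendsto x 𝒰 (𝓝 x₀)⟩ := hC.ultrafilter_le_nhds (𝒰.map x)
    (by rw [le_principal_iff]; exact Eventually.of_forall (f := (𝒰 : Filter ℕ)) hxC)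
  have hGcont : ContinuousOn (fun v => G (x₀, v)) D :=
    hGc.continuousOn.comp (by fun_prop) fun v hv => ⟨hx₀, hv⟩
  rw [Metric.tendsto_nhds]
  intro ε hε
  obtain ⟨T, hT0, hT⟩ := (hattr x₀ hx₀).uniform hD hGcont (ε := ε / 3) (by positivity)
  -- The window starts `T` before step `n`, so its curve takes the value `y n` at time `T`.
  have htime : Tendsto (fun n => stepTime γ n - T) 𝒰 atTop :=
    (tendsto_atTop_add_const_right _ (-T) hr.fast_sum).mono_left h𝒰
  have hidx := (tendsto_stepIndex hr.fast_pos hr.fast_sum).comp htime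
  have hxclose : ∀ T' ε : ℝ, 0 < ε → ∀ᶠ n in 𝒰, ∀ j, stepIndex γ (stepTime γ n - T) ≤ j →
      stepTime γ j ≤ stepTime γ n - T + T' → ‖x j - x₀‖ ≤ ε := by
    intro T' ε hε
    -- The extra `1` covers the step in progress at the window's start; the window reaches both `j`
    -- and `n`, which are compared through its first index.
    filter_upwards [hidx.eventually (hslow (max T T' + 1) (ε := ε / 3) (by positivity)),
      htime.eventually_ge_atTop 0,
      ((tendsto_add_atTop_iff_nat 1).2 hr.fast_zero |>.comp hidx).eventually_le_const zero_lt_one,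
      Metric.tendsto_nhds.1 hlim (ε / 3) (by positivity)] with n h₁ h₂ h₃ h₄ j hj hjT
    simp only [Function.comp_apply] at h₁ h₃
    have h₅ := lt_stepTime_stepIndex_succ hr.fast_pos hr.fast_sum h₂
    rw [stepTime_succ] at h₅
    have hn : stepIndex γ (stepTime γ n - T) ≤ n :=
      (stepIndex_mono hr.fast_pos hr.fast_sum h₂ (by linarith)).trans_eq
        (stepIndex_stepTime hr.fast_pos hr.fast_sum n)
    have e₁ := h₁ j hj (by linarith [le_max_right T T'])
    have e₂ := h₁ n hn (by linarith [le_max_left T T'])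
    rw [← dist_eq_norm] at e₁ e₂ ⊢
    have e₃ := dist_triangle (x j) (x (stepIndex γ (stepTime γ n - T))) x₀
    have e₄ := dist_triangle_left (x (stepIndex γ (stepTime γ n - T))) x₀ (x n)
    linarith
  have hsol : AsymptoticallySolves (fun v => G (x₀, v)) 𝒰
      (fun n s => y (stepIndex γ (stepTime γ n - T + s))) := by
    refine asymptoticallySolves_of_recursion hr.fast_pos hr.fast_sum hr.fast_zero hy hZ htime ?_
    intro T' ε hε
    have := eventually_norm_sub_le_of_uniformContinuousOn hGc (l := (𝒰 : Filter ℕ))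
      (P := fun n j => stepIndex γ (stepTime γ n - T) ≤ j ∧
        stepTime γ j ≤ stepTime γ n - T + T') (q := fun j => (x j, y j)) (q' := fun j => (x₀, y j))
      (fun j => ⟨hxC j, hyD j⟩) (fun j => ⟨hx₀, hyD j⟩) (fun ε hε => by
        filter_upwards [hxclose T' ε hε] with n hn j hj
        rw [dist_prod_same_right, dist_eq_norm]
        exact hn j hj.1 hj.2) hε
    filter_upwards [this] with n hn j hj hj'
    exact hn j ⟨hj, hj'⟩
  obtain ⟨u, hu, hunif⟩ := hsol.exists_isSolutionIn hD hGcont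
    (Eventually.of_forall fun n s _ => hyD _)
  have hstar : Tendsto (fun n => yStar (x n)) 𝒰 (𝓝 (yStar x₀)) :=
    (hcont x₀ hx₀).tendsto.comp
      (tendsto_nhdsWithin_iff.2 ⟨hlim, Eventually.of_forall hxC⟩)
  filter_upwards [hunif T (ε / 3) (by positivity),
    Metric.tendsto_nhds.1 hstar (ε / 3) (by positivity)] with n h₁ h₂
  have e₁ := h₁ T ⟨hT0, le_rfl⟩
  rw [sub_add_cancel, stepIndex_stepTime hr.fast_pos hr.fast_sum, ← dist_eq_norm] at e₁
  have e₂ := hT _ u hu T le_rfl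
  rw [dist_zero_right, norm_norm, ← dist_eq_norm]
  linarith [dist_triangle4 (y n) (u T) (yStar x₀) (yStar (x n)),
    dist_comm (yStar x₀) (yStar (x n))]

/-- The interpolated slow iterates are an asymptotic pseudotrajectory of the slow semiflow. -/
theorem LearningRates.isAsymptoticPseudotrajectoryWithin (hr : LearningRates α γ)
    (hx : ∀ n, x (n + 1) = x n + α (n + 1) • (F (x n, y n) + W (n + 1)))
    (hW : VanishingNoise α W)
    (hC : IsCompact C) (hxC : ∀ n, x n ∈ C) (hyD : ∀ n, y n ∈ D)
    (hFb : Bornology.IsBounded (F '' (C ×ˢ D))) (hFc : UniformContinuousOn F (C ×ˢ D))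
    (hmaps : ∀ u ∈ C, yStar u ∈ D) (hcont : ContinuousOn yStar C)
    (htrack : Tendsto (fun n => ‖y n - yStar (x n)‖) atTop (𝓝 0))
    (hslow : HasUniqueSolutionsIn (fun u => F (u, yStar u)) C) {Φ : Flow ℝ≥0 C}
    (hΦ : IsInducedBy Φ (fun u => F (u, yStar u))) :
    IsAsymptoticPseudotrajectoryWithin Φ (interpolation α x) := by
  refine ⟨continuous_interpolation hr.slow_pos hr.slow_sum x, fun T _ => ?_⟩
  obtain ⟨M, hM⟩ := hFb.exists_norm_le
  have hFM : ∀ n, ‖F (x n, y n)‖ ≤ M := fun n => hM _ ⟨_, ⟨hxC n, hyD n⟩, rfl⟩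
  have hf : ContinuousOn (fun u => F (u, yStar u)) C :=
    hFc.continuousOn.comp (continuousOn_id.prodMk hcont) fun u hu => ⟨hu, hmaps u hu⟩
  -- The distance is at most one increment of `x`, small because one step is eventually a fast
  -- window of length at most `1`.
  have hnear : ∀ ε : ℝ, 0 < ε → ∀ᶠ t : ℝ≥0 in atTop,
      dist (interpolation α x t) (x (stepIndex α t)) ≤ ε := by
    intro ε hε
    have hidx : Tendsto (fun t : ℝ≥0 => stepIndex α t) atTop atTop :=
      (tendsto_stepIndex hr.slow_pos hr.slow_sum).comp (NNReal.tendsto_coe_atTop.2 tendsto_id)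
    filter_upwards [hidx.eventually (hr.slow_almost_constant hFM hx hW 1 hε),
      hidx.eventually (((tendsto_add_atTop_iff_nat 1).2 hr.fast_zero).eventually_le_const
        zero_lt_one)] with t h₁ h₂
    rw [dist_eq_norm]
    refine (norm_interpolation_sub_le hr.slow_pos hr.slow_sum x t).trans (h₁ _ (Nat.le_succ _) ?_)
    rw [stepTime_succ]
    linarith
  rw [tendsto_iff_ultrafilter]
  intro 𝒰 h𝒰
  have hval : Tendsto (Subtype.val : {t : ℝ≥0 // interpolation α x t ∈ C} → ℝ≥0) 𝒰 atTop :=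
    tendsto_comap.mono_left h𝒰
  have hvalR : Tendsto (fun t : {t : ℝ≥0 // interpolation α x t ∈ C} => ((t : ℝ≥0) : ℝ)) 𝒰 atTop :=
    NNReal.tendsto_coe_atTop.2 hval
  have hidx := (tendsto_stepIndex hr.slow_pos hr.slow_sum).comp hvalR
  have hsol : AsymptoticallySolves (fun u => F (u, yStar u)) 𝒰
      (fun (t : {t : ℝ≥0 // interpolation α x t ∈ C}) s => x (stepIndex α ((t : ℝ≥0) + s))) := by
    refine asymptoticallySolves_of_recursion hr.slow_pos hr.slow_sum hr.slow_zero hx hW hvalR ?_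
    intro T' ε hε
    have := eventually_norm_sub_le_of_uniformContinuousOn hFc (l := (atTop : Filter ℕ))
      (P := fun n j => n ≤ j) (q := fun j => (x j, y j)) (q' := fun j => (x j, yStar (x j)))
      (fun j => ⟨hxC j, hyD j⟩) (fun j => ⟨hxC j, hmaps _ (hxC j)⟩) (fun ε hε => by
        obtain ⟨N, hN⟩ := eventually_atTop.1 (htrack.eventually_le_const hε)
        filter_upwards [eventually_ge_atTop N] with n hn j hj
        rw [dist_prod_same_left, dist_eq_norm]
        exact hN j (hn.trans hj)) hε
    filter_upwards [hidx.eventually this] with t ht j hj _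
    exact ht j hj
  obtain ⟨u, hu, hunif⟩ := hsol.exists_isSolutionIn hC hf
    (Eventually.of_forall fun t s _ => hxC _)
  have hstart : Tendsto (fun t : {t : ℝ≥0 // interpolation α x t ∈ C} => interpolation α x t) 𝒰
      (𝓝 (u 0)) := by
    rw [Metric.tendsto_nhds]
    intro ε hε
    filter_upwards [hval.eventually (hnear (ε / 3) (by positivity)),
      hunif 0 (ε / 3) (by positivity)] with t h₁ h₂
    have := h₂ 0 ⟨le_rfl, le_rfl⟩
    rw [add_zero, ← dist_eq_norm] at this
    linarith [dist_triangle (interpolation α x t) (x (stepIndex α (t : ℝ≥0))) (u 0)]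
  rw [ENNReal.tendsto_nhds_zero]
  intro ε hε
  -- A finite tolerance, as `ε` may be `∞`. It is split between interpolation and iterates, iterates
  -- and `u`, `u` and the semiflow.
  obtain ⟨r, hr0, hrε⟩ := ENNReal.lt_iff_exists_nnreal_btwn.1 hε
  have hr0' : (0 : ℝ) < r := by exact_mod_cast hr0
  have hflow := hslow.eventually_close hC hf (𝒰 := 𝒰)
    (g := fun t (s : ℝ) => (Φ s.toNNReal ⟨interpolation α x t.1, t.2⟩ : X))
    (p := fun t => interpolation α x t.1) (fun t => hΦ ⟨interpolation α x t.1, t.2⟩) hu hstart T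
    (ε := r / 3) (by positivity)
  obtain ⟨t₀, ht₀⟩ := eventually_atTop.1 (hnear (r / 3) (by positivity))
  filter_upwards [hflow, hunif T (r / 3) (by positivity), hval.eventually_ge_atTop t₀]
    with t h₁ h₂ h₃
  refine (iSup₂_le fun s hs => ?_).trans hrε.le
  rw [edist_le_coe, ← NNReal.coe_le_coe, coe_nndist]
  have hs' : (s : ℝ) ∈ Icc (0 : ℝ) T := ⟨s.2, by exact_mod_cast hs.2⟩
  have e₁ := h₁ s hs'
  have e₂ := h₂ s hs'
  have e₃ := ht₀ (t.1 + s) (h₃.trans le_self_add)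
  rw [Real.toNNReal_coe, ← dist_eq_norm] at e₁
  rw [← dist_eq_norm] at e₂
  rw [NNReal.coe_add] at e₃
  have e₄ := dist_triangle4 (interpolation α x (t.1 + s)) (x (stepIndex α (t.1 + s))) (u s)
    (Φ s ⟨interpolation α x t.1, t.2⟩ : X)
  rw [dist_comm (u s)] at e₄
  linarith

lemma IsAsymptoticPseudotrajectoryWithin.codRestrict {E : Type*} [MetricSpace E] {S : Set E}
    {Φ : Flow ℝ≥0 S} {z : ℝ≥0 → E} (hz : IsAsymptoticPseudotrajectoryWithin Φ z)
    (h : ∀ t, z t ∈ S) : IsAsymptoticPseudotrajectory Φ (fun t => ⟨z t, h t⟩) := by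
  refine ⟨hz.1.subtype_mk h, fun T hT => ?_⟩
  have : Tendsto (fun t : ℝ≥0 => (⟨t, h t⟩ : {t : ℝ≥0 // z t ∈ S})) atTop
      (comap Subtype.val atTop) := tendsto_comap_iff.2 tendsto_id
  exact ((hz.2 T hT).comp this).congr fun t => by simp only [Function.comp_apply, Subtype.edist_eq]

end TwoScales

end TwoTimescale

/-! ### Almost sure statement, by working path by path -/

theorem mainTheorem3
    {X Y Ω : Type*}
    [NormedAddCommGroup X] [NormedSpace ℝ X] [CompleteSpace X]
    [NormedAddCommGroup Y] [NormedSpace ℝ Y] [CompleteSpace Y]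
    [MeasurableSpace Ω] (μ : Measure Ω) [IsProbabilityMeasure μ]
    -- the process: mean field, step sizes, iterates, noise and bias terms
    (F : X × Y → X) (G : X × Y → Y)
    (α γ : ℕ → Ω → ℝ)
    (x : ℕ → Ω → X) (y : ℕ → Ω → Y)
    (U c : ℕ → Ω → X) (V d : ℕ → Ω → Y)
    (hx : ∀ᵐ ω ∂μ, ∀ n, x (n + 1) ω =
      x n ω + α (n + 1) ω • (F (x n ω, y n ω) + U (n + 1) ω + c (n + 1) ω))
    (hy : ∀ᵐ ω ∂μ, ∀ n, y (n + 1) ω =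
      y n ω + γ (n + 1) ω • (G (x n ω, y n ω) + V (n + 1) ω + d (n + 1) ω))
    -- noise control
    (hU : ∀ᵐ ω ∂μ, TwoTimescale.NoiseControl (fun n => α n ω) (fun n => U n ω))
    (hV : ∀ᵐ ω ∂μ, TwoTimescale.NoiseControl (fun n => γ n ω) (fun n => V n ω))
    (hc : ∀ᵐ ω ∂μ, Tendsto (fun n => c n ω) atTop (𝓝 0))
    (hd : ∀ᵐ ω ∂μ, Tendsto (fun n => d n ω) atTop (𝓝 0))
    -- boundedness and continuity
    (C : Set X) (D : Set Y) (hC : IsCompact C) (hD : IsCompact D)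
    (hxC : ∀ᵐ ω ∂μ, ∀ n, x n ω ∈ C) (hyD : ∀ᵐ ω ∂μ, ∀ n, y n ω ∈ D)
    (hFb : Bornology.IsBounded (F '' (C ×ˢ D))) (hFc : UniformContinuousOn F (C ×ˢ D))
    (hGb : Bornology.IsBounded (G '' (C ×ˢ D))) (hGc : UniformContinuousOn G (C ×ˢ D))
    -- learning rates
    (hrates : ∀ᵐ ω ∂μ, TwoTimescale.LearningRates (fun n => α n ω) (fun n => γ n ω))
    -- mean field behaviour
    (yStar : X → Y)
    (hfast : ∀ x₀ ∈ C, TwoTimescale.HasUniqueSolutionsIn (fun v => G (x₀, v)) D)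
    (hattr : ∀ x₀ ∈ C,
      TwoTimescale.IsGloballyAttractingFixedPoint (fun v => G (x₀, v)) D (yStar x₀))
    (hLip : ∃ K : ℝ≥0, LipschitzOnWith K yStar C)
    (hslow : TwoTimescale.HasUniqueSolutionsIn (fun u => F (u, yStar u)) C) :
    (∀ᵐ ω ∂μ, Tendsto (fun n => ‖y n ω - yStar (x n ω)‖) atTop (𝓝 0)) ∧
    ∃ Φ : Flow ℝ≥0 C,
      TwoTimescale.IsInducedBy Φ (fun u => F (u, yStar u)) ∧
      ∀ᵐ ω ∂μ,
        TwoTimescale.IsAsymptoticPseudotrajectoryWithin Φ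
          (TwoTimescale.interpolation (fun n => α n ω) (fun n => x n ω)) ∧
        ∀ h : ∀ t, TwoTimescale.interpolation (fun n => α n ω) (fun n => x n ω) t ∈ C,
          TwoTimescale.IsAsymptoticPseudotrajectory Φ
            (fun t => ⟨TwoTimescale.interpolation (fun n => α n ω) (fun n => x n ω) t, h t⟩) := by
  obtain ⟨L, hL⟩ := hLip
  have hcont : ContinuousOn yStar C := hL.continuousOn
  have hmaps : ∀ u ∈ C, yStar u ∈ D := fun u hu => (hattr u hu).mem
  have hf : ContinuousOn (fun u => F (u, yStar u)) C :=
    hFc.continuousOn.comp (continuousOn_id.prodMk hcont) fun u hu => ⟨hu, hmaps u hu⟩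
  have htrack : ∀ᵐ ω ∂μ, Tendsto (fun n => ‖y n ω - yStar (x n ω)‖) atTop (𝓝 0) := by
    filter_upwards [hx, hy, hU, hV, hc, hd, hxC, hyD, hrates]
      with ω hx hy hU hV hc hd hxC hyD hr
    exact hr.tendsto_norm_sub_yStar
      (W := fun n => U n ω + c n ω) (Z := fun n => V n ω + d n ω)
      (fun n => by rw [hx n, add_assoc (F _)]) (fun n => by rw [hy n, add_assoc (G _)])
      ((hU.vanishingNoise hr.slow_pos hr.slow_sum).add_of_tendsto_zero hr.slow_pos hc)
      ((hV.vanishingNoise hr.fast_pos hr.fast_sum).add_of_tendsto_zero hr.fast_pos hd)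
      hC hD hxC hyD hFb hGc hattr hcont
  refine ⟨htrack, ?_⟩
  obtain ⟨Φ, hΦ⟩ := hslow.exists_flow hC hf
  refine ⟨Φ, hΦ, ?_⟩
  filter_upwards [hx, hU, hc, hxC, hyD, hrates, htrack] with ω hx hU hc hxC hyD hr htrack
  have hAPT := hr.isAsymptoticPseudotrajectoryWithin (W := fun n => U n ω + c n ω)
    (fun n => by rw [hx n, add_assoc (F _)])
    ((hU.vanishingNoise hr.slow_pos hr.slow_sum).add_of_tendsto_zero hr.slow_pos hc)
    hC hxC hyD hFb hFc hmaps hcont htrack hslow hΦ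
  exact ⟨hAPT, fun h => hAPT.codRestrict h⟩
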